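/- Let $(K,d)$ be a compact metric space and let $\mathcal M=(K_{i(e)},w_e,p_e)_{e\in E}$ be a finite Markov system on $K$. That is, $K$ is partitioned into finitely many nonempty Borel sets $K_1,\dots,K_N$, $E$ is a finite set of edges, each with an initial vertex $i(e)$ and a terminal vertex $t(e)$ in $\{1,\dots,N\}$, $w_e:K_{i(e)}\to K_{t(e)}$ and $p_e:K_{i(e)}\to[0,1]$ are Borel maps for all $e\in E$, and $\sum_{e:\,i(e)=j}p_e(x)=1$ for all $x\in K_j$ and all $j$. Extend $p_e$ to $K$ by $0$ and $w_e$ arbitrarily. Assume that for every $e\in E$ the set $K_{i(e)}$ is open in $K$, $w_e|_{K_{i(e)}}$ is continuous, and $p_e|_{K_{i(e)}}$ is continuous and bounded away from zero. Suppose that $\mu$ is the unique invariant Borel probability measure of $\mathcal M$, that is, the unique Borel probability measure with $\int\sum_{e\in E}p_e\,(g\circ w_e)\,d\mu=\int g\,d\mu$ for all bounded continuous $g:K\to\mathbb R$. For $x\in K$ let $P_x$ be the Borel probability measure on $\Sigma^+=E^{\mathbb N}=\{(\sigma_1,\sigma_2,\dots)\}$ (with the product topology of discrete topologies) such that, for all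 $n\ge1$ and $e_1,\dots,e_n\in E$, $$P_x\big(\{\sigma:\sigma_1=e_1,\dots,\sigma_n=e_n\}\big)=p_{e_1}(x)\,p_{e_2}(w_{e_1}(x))\cdots p_{e_n}(w_{e_{n-1}}\circ\dots\circ w_{e_1}(x)).$$ For every $e\in E$ let $f_e:K\to[-\infty,+\infty]$ be Borel measurable such that $f_e|_{K_{i(e)}}$ is real-valued and continuous. Then each $p_ef_e$ is $\mu$-integrable on $K_{i(e)}$, and for every $x\in K$ $$\lim_{n\to\infty}\frac1n\sum_{k=0}^{n-1}f_{\sigma_{k+1}}\big(w_{\sigma_k}\circ\dots\circ w_{\sigma_1}(x)\big)=\sum_{e\in E}\int_{K_{i(e)}}p_ef_e\,d\mu$$ for $P_x$-almost every $\sigma\in\Sigma^+$ (for $k=0$ the argument of $f_{\sigma_1}$ is $x$). -/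

import Mathlib

open MeasureTheory ProbabilityTheory Filter Topology
open scoped BoundedContinuousFunction ENNReal

/-- A Markov system `(K_{i(e)}, w_e, p_e)_{e ∈ E}` on a metric space `K`, with vertex set `V`
and edge set `E`: a partition of `K` into nonempty Borel sets `K_v`, and for every edge `e` a
Borel map `w_e` from `K_{i(e)}` into `K_{t(e)}` and a Borel probability function `p_e` on
`K_{i(e)}`, such that the probabilities of the edges that start at `v` add up to one on `K_v`.
As usual `p_e` is extended to `K` by zero, and `w_e` is extended to `K` arbitrarily. -/
structure MarkovSystem (K : Type*) [MetricSpace K] [MeasurableSpace K]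
    (V : Type*) (E : Type*) [Fintype E] where
  /-- the vertex sets `K_v` -/
  cell : V → Set K
  /-- the initial vertex of an edge -/
  i : E → V
  /-- the terminal vertex of an edge -/
  t : E → V
  /-- the maps -/
  w : E → K → K
  /-- the probability functions -/
  p : E → K → ℝ
  cell_nonempty : ∀ v, (cell v).Nonempty
  measurableSet_cell : ∀ v, MeasurableSet (cell v)
  disjoint_cell : ∀ u v, u ≠ v → Disjoint (cell u) (cell v)
  iUnion_cell : ⋃ v, cell v = Set.univ
  measurable_w : ∀ e, Measurable ((cell (i e)).domRestrict (w e))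
  mapsTo_w : ∀ e, Set.MapsTo (w e) (cell (i e)) (cell (t e))
  measurable_p : ∀ e, Measurable (p e)
  p_nonneg : ∀ e x, 0 ≤ p e x
  p_eq_zero : ∀ e x, x ∉ cell (i e) → p e x = 0
  sum_p : ∀ x, ∑ e, p e x = 1

namespace MarkovSystem

variable {K : Type*} [MetricSpace K] [MeasurableSpace K] {V E : Type*} [Fintype E]

/-- The Markov operator `U g = ∑ e, p_e · (g ∘ w_e)`. -/
noncomputable def U (M : MarkovSystem K V E) (g : K → ℝ) : K → ℝ :=
  fun x => ∑ e, M.p e x * g (M.w e x)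

/-- The measure `ν` is invariant, `U* ν = ν`: `∫ U g dν = ∫ g dν` for all bounded continuous
`g`. -/
def IsInvariant (M : MarkovSystem K V E) (ν : Measure K) : Prop :=
  ∀ g : K →ᵇ ℝ, ∫ x, M.U g x ∂ν = ∫ x, g x ∂ν

/-- `X_k(σ) = w_{σ_k} ∘ ⋯ ∘ w_{σ_1} (x)`, with `X_0(σ) = x`. The sequences `σ ∈ Σ⁺` are indexed
from zero here, so that `σ k` is the edge used in step `k + 1`. -/
def orbit (M : MarkovSystem K V E) (x : K) (σ : ℕ → E) : ℕ → K
  | 0 => x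
  | k + 1 => M.w (σ k) (M.orbit x σ k)

lemma orbit_congr (M : MarkovSystem K V E) (x : K) {σ τ : ℕ → E} (n : ℕ)
    (h : ∀ k < n, σ k = τ k) : M.orbit x σ n = M.orbit x τ n := by
  induction n with
  | zero => rfl
  | succ n ih =>
    simp only [orbit]
    rw [h n (by omega), ih (fun k hk => h k (by omega))]

variable [MeasurableSpace E]

/-- The law of the edge chosen at the point `y`: the edge `e` is chosen with probability
`p_e(y)`. -/
noncomputable def edgeLaw (M : MarkovSystem K V E) (y : K) : Measure E :=
  ∑ e, ENNReal.ofReal (M.p e y) • Measure.dirac e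

instance isProbabilityMeasure_edgeLaw (M : MarkovSystem K V E) (y : K) :
    IsProbabilityMeasure (M.edgeLaw y) := by
  constructor
  simp only [edgeLaw, Measure.coe_finsetSum, Finset.sum_apply, Measure.smul_apply,
    measure_univ, smul_eq_mul, mul_one]
  rw [← ENNReal.ofReal_sum_of_nonneg (fun e _ => M.p_nonneg e y), M.sum_p, ENNReal.ofReal_one]

variable [MeasurableSingletonClass E]

lemma edgeLaw_singleton (M : MarkovSystem K V E) (y : K) (e : E) :
    M.edgeLaw y {e} = ENNReal.ofReal (M.p e y) := by
  classical
  simp only [edgeLaw, Measure.coe_finsetSum, Finset.sum_apply, Measure.smul_apply,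
    smul_eq_mul, Measure.dirac_apply]
  rw [Finset.sum_eq_single e]
  · simp
  · intro b _ hb
    simp [hb]
  · simp

/-- The law of the next edge after the edges `h 0, …, h n` were used, for the process started
at `x`. -/
noncomputable def edgeKernel (M : MarkovSystem K V E) (x : K) (n : ℕ) :
    Kernel (Finset.Iic n → E) E :=
  Kernel.ofFunOfCountable fun h =>
    M.edgeLaw (M.orbit x (fun k => h ⟨min k n, Finset.mem_Iic.2 (min_le_right k n)⟩) (n + 1))

instance isMarkovKernel_edgeKernel (M : MarkovSystem K V E) (x : K) (n : ℕ) :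
    IsMarkovKernel (M.edgeKernel x n) :=
  ⟨fun h => M.isProbabilityMeasure_edgeLaw
    (M.orbit x (fun k => h ⟨min k n, Finset.mem_Iic.2 (min_le_right k n)⟩) (n + 1))⟩

/-- The measure `P_x` on `Σ⁺`; its values on cylinders are computed in
`pathMeasure_cylinder`. -/
noncomputable def pathMeasure (M : MarkovSystem K V E) (x : K) : Measure (ℕ → E) :=
  Kernel.trajMeasure (X := fun _ => E) (M.edgeLaw x) (M.edgeKernel x)

instance isProbabilityMeasure_pathMeasure (M : MarkovSystem K V E) (x : K) :
    IsProbabilityMeasure (M.pathMeasure x) := by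
  unfold pathMeasure
  infer_instance

/-- `P_x([e_1, …, e_n]) = p_{e_1}(x) p_{e_2}(w_{e_1} x) ⋯ p_{e_n}(w_{e_{n-1}} ∘ ⋯ ∘ w_{e_1} x)`. -/
theorem pathMeasure_cylinder (M : MarkovSystem K V E) (x : K) (τ : ℕ → E) (n : ℕ) :
    M.pathMeasure x {σ | ∀ k < n, σ k = τ k} =
      ENNReal.ofReal (∏ k ∈ Finset.range n, M.p (τ k) (M.orbit x τ k)) := by
  have hset : ∀ a : ℕ, {σ : ℕ → E | ∀ k < a + 1, σ k = τ k} =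
      (Preorder.frestrictLe (π := fun _ => E) a) ⁻¹' {Preorder.frestrictLe (π := fun _ => E) a τ} := by
    intro a
    ext σ
    simp only [Set.mem_ofPred_eq, Set.mem_preimage, Set.mem_singleton_iff, funext_iff,
      Preorder.frestrictLe_apply, Subtype.forall, Finset.mem_Iic, Nat.lt_succ_iff]
  match n with
  | 0 => simp
  | n + 1 =>
    induction n with
    | zero =>
      have h0 : (M.pathMeasure x).map (Preorder.frestrictLe (π := fun _ => E) 0) =
          (M.edgeLaw x).map
            (MeasurableEquiv.piUnique (fun _ : Finset.Iic 0 => E)).symm := by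
        rw [pathMeasure, Kernel.trajMeasure, Measure.map_comp _ _ (by fun_prop),
          Kernel.traj_map_frestrictLe, Kernel.partialTraj_self, Measure.id_comp]
      rw [hset 0, ← Measure.map_apply (by fun_prop) (measurableSet_singleton _), h0,
        Measure.map_apply (by fun_prop) (measurableSet_singleton _)]
      have : (MeasurableEquiv.piUnique (fun _ : Finset.Iic 0 => E)).symm ⁻¹'
          {Preorder.frestrictLe (π := fun _ => E) 0 τ} = {τ 0} := by
        ext e
        simp only [Set.mem_preimage, Set.mem_singleton_iff]
        rw [MeasurableEquiv.symm_apply_eq]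
        rfl
      rw [this, edgeLaw_singleton]
      simp [orbit]
    | succ a ih =>
      have hs : {σ : ℕ → E | ∀ k < a + 1 + 1, σ k = τ k} =
          (fun σ : ℕ → E => (Preorder.frestrictLe (π := fun _ => E) a σ, σ (a + 1))) ⁻¹'
            ({Preorder.frestrictLe (π := fun _ => E) a τ} ×ˢ {τ (a + 1)}) := by
        have := hset a
        ext σ
        have h1 := Set.ext_iff.1 this σ
        simp only [Set.mem_ofPred_eq, Set.mem_preimage] at h1
        simp only [Set.mem_ofPred_eq, Set.mem_preimage, Set.mem_prod, ← h1,
          Set.mem_singleton_iff]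
        constructor
        · exact fun h => ⟨fun k hk => h k (by omega), h _ (by omega)⟩
        · rintro ⟨h2, h3⟩ k hk
          rcases Nat.lt_succ_iff_lt_or_eq.1 hk with hk | rfl
          · exact h2 k hk
          · exact h3
      have hm : MeasurableSet
          (({Preorder.frestrictLe (π := fun _ => E) a τ} : Set (Finset.Iic a → E)) ×ˢ
            ({τ (a + 1)} : Set E)) :=
        (measurableSet_singleton _).prod (measurableSet_singleton _)
      rw [hs, ← Measure.map_apply (by fun_prop) hm, pathMeasure,
        ← Kernel.map_frestrictLe_trajMeasure_compProd_eq_map_trajMeasure (X := fun _ => E),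
        Measure.compProd_apply_prod (measurableSet_singleton _) (measurableSet_singleton _),
        lintegral_singleton, Measure.map_apply (by fun_prop) (measurableSet_singleton _),
        ← hset a]
      change _ * M.pathMeasure x _ = _
      rw [ih, Finset.prod_range_succ _ (a + 1), mul_comm, ENNReal.ofReal_mul
        (Finset.prod_nonneg fun k _ => M.p_nonneg _ _)]
      congr 1
      change M.edgeLaw _ _ = _
      rw [edgeLaw_singleton]
      congr 2
      apply M.orbit_congr
      intro k hk
      simp [Nat.lt_succ_iff.1 hk]

end MarkovSystem

/-! Write X_k for `M.orbit x σ k`. The cells with an outgoing edge are open and cover K, hence are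
clopen, so functions continuous on a cell and extended by zero are continuous on the compact space
K. For continuous h_e, the differences h_{σ k}(X_k) - ∑ p_e(X_k) h_e(X_k) are bounded and
conditionally centred; exponential moments show that their averages vanish almost surely
(`ae_tendsto_average_sub`).

It remains to average the continuous function ∑ p_e h_e along the orbit. Applied to g ∘ w_e, the
same law together with telescoping makes the averages of U g - g vanish, almost surely for all g ∈
C(K) at once by separability. Since U preserves C(K), every weak limit point of the empirical
measures is then invariant, so it is μ; compactness of the space of probability measures turns this
into convergence (`tendsto_average_of_unique_invariant`). -/

namespace MarkovSystem

/-! ### Finite words -/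

section Words

variable {E : Type*}

/-- The infinite word that starts with `τ` and continues with the letter `e₀`. -/
def extendWord (e₀ : E) (n : ℕ) (τ : Fin n → E) : ℕ → E :=
  fun k => if h : k < n then τ ⟨k, h⟩ else e₀

lemma extendWord_of_lt (e₀ : E) {n k : ℕ} (τ : Fin n → E) (h : k < n) :
    extendWord e₀ n τ k = τ ⟨k, h⟩ := dif_pos h

lemma extendWord_snoc_of_lt (e₀ : E) {n k : ℕ} (τ : Fin n → E) (e : E) (h : k < n) :
    extendWord e₀ (n + 1) (Fin.snocEquiv (fun _ => E) (e, τ)) k = extendWord e₀ n τ k := by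
  rw [extendWord_of_lt e₀ _ (Nat.lt_succ_of_lt h), extendWord_of_lt e₀ _ h]
  simp [Fin.snocEquiv, Fin.snoc, h]

lemma extendWord_snoc_self (e₀ : E) {n : ℕ} (τ : Fin n → E) (e : E) :
    extendWord e₀ (n + 1) (Fin.snocEquiv (fun _ => E) (e, τ)) n = e := by
  rw [extendWord_of_lt e₀ _ (Nat.lt_succ_self n)]
  simp [Fin.snocEquiv, Fin.snoc]

end Words

/-! ### Finite-dimensional integrals and the Markov property -/

section PathLaw

variable {K : Type*} [MetricSpace K] [MeasurableSpace K] {V E : Type*} [Fintype E]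

lemma exists_edge (M : MarkovSystem K V E) (x : K) : ∃ e, x ∈ M.cell (M.i e) := by
  by_contra! h
  have h1 := M.sum_p x
  simp [fun e => M.p_eq_zero e x (h e)] at h1

lemma orbit_dependsOn (M : MarkovSystem K V E) (x : K) (n : ℕ) :
    DependsOn (fun σ : ℕ → E => M.orbit x σ n) (Set.Iio n) :=
  fun _ _ h => M.orbit_congr x n fun k hk => h k hk

lemma step_dependsOn {α : Type*} (M : MarkovSystem K V E) (x : K) (h : E → K → α) (n : ℕ) :
    DependsOn (fun σ : ℕ → E => h (σ n) (M.orbit x σ n)) (Set.Iio (n + 1)) := by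
  intro σ τ hστ
  have h1 : M.orbit x σ n = M.orbit x τ n :=
    M.orbit_congr x n fun k hk => hστ k (Nat.lt_succ_of_lt hk)
  simp only [h1, hστ n (Nat.lt_succ_self n)]

lemma sum_dependsOn (M : MarkovSystem K V E) (x : K) (h : E → K → ℝ) (n : ℕ) :
    DependsOn (fun σ : ℕ → E => ∑ k ∈ Finset.range n, h (σ k) (M.orbit x σ k)) (Set.Iio n) := by
  intro σ τ hστ
  refine Finset.sum_congr rfl fun k hk => ?_
  have hk' := Finset.mem_range.1 hk
  exact M.step_dependsOn x h k fun j hj => hστ j (by simp only [Set.mem_Iio] at *; omega)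

variable [MeasurableSpace E] [MeasurableSingletonClass E]

lemma measurable_of_dependsOn {α : Type*} [MeasurableSpace α] (e₀ : E) {n : ℕ}
    {G : (ℕ → E) → α} (hG : DependsOn G (Set.Iio n)) : Measurable G := by
  have h : G = (fun τ : Fin n → E => G (extendWord e₀ n τ)) ∘ fun σ (k : Fin n) => σ k := by
    ext σ
    exact hG fun k hk => (extendWord_of_lt e₀ (fun j : Fin n => σ j) hk).symm
  rw [h]
  exact (measurable_of_countable _).comp (by fun_prop)

/-- The integrand factors through the first n letters, whose law is given by the cylinder formula.
-/
lemma lintegral_of_dependsOn (M : MarkovSystem K V E) (x : K) (e₀ : E) {n : ℕ}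
    {G : (ℕ → E) → ℝ≥0∞} (hG : DependsOn G (Set.Iio n)) :
    ∫⁻ σ, G σ ∂(M.pathMeasure x) = ∑ τ : Fin n → E, G (extendWord e₀ n τ) *
      ENNReal.ofReal (∏ k ∈ Finset.range n,
        M.p (extendWord e₀ n τ k) (M.orbit x (extendWord e₀ n τ) k)) := by
  have hr : Measurable fun (σ : ℕ → E) (k : Fin n) => σ k := by fun_prop
  have h : G = fun σ => (fun τ : Fin n → E => G (extendWord e₀ n τ)) (fun k : Fin n => σ k) := by
    ext σ
    exact hG fun k hk => (extendWord_of_lt e₀ (fun j : Fin n => σ j) hk).symm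
  conv_lhs => rw [h]
  rw [← lintegral_map (μ := M.pathMeasure x) (measurable_of_countable _) hr, lintegral_fintype]
  refine Finset.sum_congr rfl fun τ _ => ?_
  rw [Measure.map_apply hr (measurableSet_singleton _), ← pathMeasure_cylinder]
  congr 2
  ext σ
  simp only [Set.mem_preimage, Set.mem_singleton_iff, funext_iff, Set.mem_ofPred_eq]
  exact ⟨fun H k hk => by rw [extendWord_of_lt e₀ _ hk]; exact H ⟨k, hk⟩,
    fun H k => by rw [H k k.2, extendWord_of_lt e₀ _ k.2]⟩

/-- The Markov property of the path measure. -/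
lemma lintegral_step (M : MarkovSystem K V E) (x : K) (e₀ : E) {n : ℕ} {Φ : (ℕ → E) → ℝ≥0∞}
    (hΦ : DependsOn Φ (Set.Iio n)) (h : E → K → ℝ≥0∞) :
    ∫⁻ σ, Φ σ * h (σ n) (M.orbit x σ n) ∂(M.pathMeasure x) =
      ∫⁻ σ, Φ σ * ∑ e, ENNReal.ofReal (M.p e (M.orbit x σ n)) * h e (M.orbit x σ n)
        ∂(M.pathMeasure x) := by
  have hl : DependsOn (fun σ => Φ σ * h (σ n) (M.orbit x σ n)) (Set.Iio (n + 1)) := by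
    intro σ τ hστ
    have h1 := M.step_dependsOn x h n hστ
    have h2 : Φ σ = Φ τ := hΦ fun k hk => hστ k (Nat.lt_succ_of_lt hk)
    simp only at h1 ⊢
    rw [h1, h2]
  have hr : DependsOn (fun σ => Φ σ *
      ∑ e, ENNReal.ofReal (M.p e (M.orbit x σ n)) * h e (M.orbit x σ n)) (Set.Iio n) := by
    intro σ τ hστ
    have h1 := M.orbit_dependsOn x n hστ
    simp only at h1 ⊢
    rw [h1, hΦ hστ]
  -- Words of length n + 1 are split into a word of length n and a last letter e; the extra factor
  -- of the weight is `M.p e` at the n-th orbit point.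
  rw [M.lintegral_of_dependsOn x e₀ hl, M.lintegral_of_dependsOn x e₀ hr,
    ← (Fin.snocEquiv fun _ => E).sum_comp, Fintype.sum_prod_type_right]
  refine Finset.sum_congr rfl fun τ _ => ?_
  rw [Finset.mul_sum, Finset.sum_mul]
  refine Finset.sum_congr rfl fun e _ => ?_
  have hlt : ∀ m ≤ n, ∀ k < m, extendWord e₀ (n + 1) (Fin.snocEquiv (fun _ => E) (e, τ)) k =
      extendWord e₀ n τ k := fun m hm k hk => extendWord_snoc_of_lt e₀ τ e (hk.trans_le hm)
  have ho : ∀ m ≤ n, M.orbit x (extendWord e₀ (n + 1) (Fin.snocEquiv (fun _ => E) (e, τ))) m =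
      M.orbit x (extendWord e₀ n τ) m := fun m hm => M.orbit_congr x m (hlt m hm)
  have hprod : ∏ k ∈ Finset.range n,
      M.p (extendWord e₀ (n + 1) (Fin.snocEquiv (fun _ => E) (e, τ)) k)
        (M.orbit x (extendWord e₀ (n + 1) (Fin.snocEquiv (fun _ => E) (e, τ))) k) =
      ∏ k ∈ Finset.range n,
        M.p (extendWord e₀ n τ k) (M.orbit x (extendWord e₀ n τ) k) := by
    refine Finset.prod_congr rfl fun k hk => ?_
    have hk' := Finset.mem_range.1 hk
    rw [hlt n le_rfl k hk', ho k hk'.le]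
  rw [Finset.prod_range_succ, hprod, extendWord_snoc_self, ho n le_rfl,
    hΦ (fun k hk => hlt n le_rfl k hk),
    ENNReal.ofReal_mul (Finset.prod_nonneg fun k _ => M.p_nonneg _ _)]
  ring

/-- An edge is chosen at y with probability p_e(y), which vanishes off its cell: the Markov property
is applied to the indicator of the bad event. -/
lemma ae_mem_cell (M : MarkovSystem K V E) (x : K) :
    ∀ᵐ σ ∂(M.pathMeasure x), ∀ k, M.orbit x σ k ∈ M.cell (M.i (σ k)) := by
  classical
  obtain ⟨e₀, -⟩ := M.exists_edge x
  refine ae_all_iff.2 fun n => ?_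
  have h := M.lintegral_step x e₀ (n := n) (Φ := fun _ => 1) (fun _ _ _ => rfl)
    (fun e y => if y ∈ M.cell (M.i e) then 0 else 1)
  have h0 : ∀ e y, ENNReal.ofReal (M.p e y) *
      (if y ∈ M.cell (M.i e) then (0 : ℝ≥0∞) else 1) = 0 := by
    intro e y
    split_ifs with hy
    · simp
    · simp [M.p_eq_zero e y hy]
  simp only [h0, one_mul, Finset.sum_const_zero, lintegral_zero] at h
  rw [lintegral_eq_zero_iff (measurable_of_dependsOn e₀
    (M.step_dependsOn x (fun e y => if y ∈ M.cell (M.i e) then (0 : ℝ≥0∞) else 1) n))] at h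
  filter_upwards [h] with σ hσ
  by_contra hn
  simp [hn] at hσ

end PathLaw

/-! ### Strong law by exponential moments -/

section LawOfLargeNumbers

variable {K : Type*} [MetricSpace K] [MeasurableSpace K] {V E : Type*} [Fintype E]

/-- Uses exp u ≤ 1 + u + u² for |u| ≤ 1; the linear term averages to zero. -/
lemma sum_mul_exp_le (M : MarkovSystem K V E) {h : E → K → ℝ} {C l : ℝ} {y : K}
    (hC : ∀ e, |h e y| ≤ C) (h0 : ∑ e, M.p e y * h e y = 0) (hl : 0 ≤ l) (hlC : l * C ≤ 1) :
    ∑ e, M.p e y * Real.exp (l * h e y) ≤ Real.exp ((l * C) ^ 2) := by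
  have hb : ∀ e, Real.exp (l * h e y) ≤ 1 + l * h e y + (l * C) ^ 2 := by
    intro e
    have h1 : |l * h e y| ≤ l * C := by
      rw [abs_mul, abs_of_nonneg hl]
      exact mul_le_mul_of_nonneg_left (hC e) hl
    have h2 := (abs_le.1 (Real.abs_exp_sub_one_sub_id_le (h1.trans hlC))).2
    have h3 : (l * h e y) ^ 2 ≤ (l * C) ^ 2 := by
      rw [← sq_abs]
      exact pow_le_pow_left₀ (abs_nonneg _) h1 2
    linarith
  calc ∑ e, M.p e y * Real.exp (l * h e y)
      ≤ ∑ e, (M.p e y * (1 + (l * C) ^ 2) + l * (M.p e y * h e y)) := by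
        refine Finset.sum_le_sum fun e _ => ?_
        have := mul_le_mul_of_nonneg_left (hb e) (M.p_nonneg e y)
        linarith
    _ = (l * C) ^ 2 + 1 := by
        rw [Finset.sum_add_distrib, ← Finset.sum_mul, ← Finset.mul_sum, M.sum_p, h0]
        ring
    _ ≤ Real.exp ((l * C) ^ 2) := Real.add_one_le_exp _

variable [MeasurableSpace E] [MeasurableSingletonClass E]

/-- Conditioning on the past, each step costs at most one factor exp((lC)²). -/
lemma lintegral_exp_sum_le (M : MarkovSystem K V E) (x : K) {h : E → K → ℝ} {C l : ℝ}
    (hC : ∀ e y, |h e y| ≤ C) (h0 : ∀ y, ∑ e, M.p e y * h e y = 0) (hl : 0 ≤ l)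
    (hlC : l * C ≤ 1) (n : ℕ) :
    ∫⁻ σ, ENNReal.ofReal (Real.exp (l * ∑ k ∈ Finset.range n, h (σ k) (M.orbit x σ k)))
      ∂(M.pathMeasure x) ≤ ENNReal.ofReal (Real.exp ((l * C) ^ 2)) ^ n := by
  obtain ⟨e₀, -⟩ := M.exists_edge x
  induction n with
  | zero => simp
  | succ n ih =>
    have hdep : DependsOn (fun σ : ℕ → E => ENNReal.ofReal (Real.exp
        (l * ∑ k ∈ Finset.range n, h (σ k) (M.orbit x σ k)))) (Set.Iio n) := by
      intro σ τ hστ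
      have := M.sum_dependsOn x h n hστ
      simp only at this ⊢
      rw [this]
    simp only [Finset.sum_range_succ, mul_add, Real.exp_add,
      ENNReal.ofReal_mul (Real.exp_pos _).le]
    rw [M.lintegral_step x e₀ hdep (fun e y => ENNReal.ofReal (Real.exp (l * h e y))), pow_succ]
    refine le_trans ?_ (mul_le_mul_left ih _)
    rw [← lintegral_mul_const _ (measurable_of_dependsOn e₀ hdep)]
    refine lintegral_mono fun σ => mul_le_mul_right ?_ _
    simp only [← ENNReal.ofReal_mul (M.p_nonneg _ _)]
    rw [← ENNReal.ofReal_sum_of_nonneg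
      fun e _ => mul_nonneg (M.p_nonneg _ _) (Real.exp_pos _).le]
    exact ENNReal.ofReal_le_ofReal (M.sum_mul_exp_le (fun e => hC e _) (h0 _) hl hlC)

/-- Chernoff's bound with a Borel–Cantelli argument: the exponential moments, tilted by exp(-nlε),
are dominated by a geometric series. -/
lemma ae_eventually_sum_le (M : MarkovSystem K V E) (x : K) {h : E → K → ℝ} {C : ℝ}
    (hC : ∀ e y, |h e y| ≤ C) (h0 : ∀ y, ∑ e, M.p e y * h e y = 0) {ε : ℝ} (hε : 0 < ε) :
    ∀ᵐ σ ∂(M.pathMeasure x), ∀ᶠ n : ℕ in atTop,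
      ∑ k ∈ Finset.range n, h (σ k) (M.orbit x σ k) < n * ε := by
  obtain ⟨e₀, -⟩ := M.exists_edge x
  obtain ⟨B, hB, hCB⟩ : ∃ B : ℝ, 0 < B ∧ C ≤ B :=
    ⟨max C 1, lt_max_of_lt_right one_pos, le_max_left _ _⟩
  -- The first bound gives lB ≤ 1; the second gives (lB)² ≤ lε/2, so that r < 1.
  set l : ℝ := min (1 / B) (ε / (2 * B ^ 2)) with hl_def
  have hl : 0 < l := lt_min (by positivity) (by positivity)
  have hlB : l * B ≤ 1 := by
    rw [← le_div_iff₀ hB]; exact min_le_left _ _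
  have hlB2 : l * (2 * B ^ 2) ≤ ε := by
    rw [← le_div_iff₀ (by positivity)]; exact min_le_right _ _
  set r : ℝ := Real.exp ((l * B) ^ 2 - l * ε) with hr_def
  have hr1 : r < 1 := by
    rw [hr_def, Real.exp_lt_one_iff]
    nlinarith [mul_le_mul_of_nonneg_left hlB2 hl.le, mul_pos hl hε]
  have hmeas : ∀ n : ℕ, Measurable fun σ : ℕ → E => ENNReal.ofReal (Real.exp
      (l * ∑ k ∈ Finset.range n, h (σ k) (M.orbit x σ k))) *
        ENNReal.ofReal (Real.exp (-(l * ε))) ^ n := by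
    intro n
    refine Measurable.mul_const ?_ _
    have := measurable_of_dependsOn e₀ (M.sum_dependsOn x h n)
    fun_prop
  have hbound : ∀ n : ℕ, ∫⁻ σ, ENNReal.ofReal (Real.exp
      (l * ∑ k ∈ Finset.range n, h (σ k) (M.orbit x σ k))) *
        ENNReal.ofReal (Real.exp (-(l * ε))) ^ n ∂(M.pathMeasure x) ≤ ENNReal.ofReal r ^ n := by
    intro n
    have hm := measurable_of_dependsOn e₀ (M.sum_dependsOn x h n)
    rw [lintegral_mul_const _ (by fun_prop)]
    refine (mul_le_mul_left (M.lintegral_exp_sum_le x (fun e y => (hC e y).trans hCB) h0 hl.le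
      hlB n) _).trans_eq ?_
    rw [← mul_pow, ← ENNReal.ofReal_mul (Real.exp_pos _).le, ← Real.exp_add, hr_def,
      sub_eq_add_neg]
  have hfin : ∫⁻ σ, ∑' n : ℕ, ENNReal.ofReal (Real.exp
      (l * ∑ k ∈ Finset.range n, h (σ k) (M.orbit x σ k))) *
        ENNReal.ofReal (Real.exp (-(l * ε))) ^ n ∂(M.pathMeasure x) ≠ ∞ := by
    rw [lintegral_tsum fun n => (hmeas n).aemeasurable]
    refine ne_top_of_le_ne_top ?_ (ENNReal.tsum_le_tsum hbound)
    rw [ENNReal.tsum_geometric]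
    refine ENNReal.inv_ne_top.2 (tsub_pos_of_lt ?_).ne'
    rwa [← ENNReal.ofReal_one, ENNReal.ofReal_lt_ofReal_iff one_pos]
  filter_upwards [ae_lt_top (Measurable.tsum hmeas) hfin] with σ hσ
  -- The terms of a finite series are eventually below 1, which says that the exponent l(S_n - nε)
  -- is negative.
  have ht := ENNReal.tendsto_atTop_zero_of_tsum_ne_top hσ.ne
  filter_upwards [ht.eventually_lt_const one_pos] with n hn
  rw [← ENNReal.ofReal_pow (Real.exp_pos _).le, ← ENNReal.ofReal_mul (Real.exp_pos _).le,
    ← Real.exp_nat_mul, ← Real.exp_add, ← ENNReal.ofReal_one,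
    ENNReal.ofReal_lt_ofReal_iff one_pos, Real.exp_lt_one_iff] at hn
  nlinarith

/-- The strong law of large numbers for centred bounded functions of the steps of the process. -/
theorem ae_tendsto_average_of_centered (M : MarkovSystem K V E) (x : K) {h : E → K → ℝ} {C : ℝ}
    (hC : ∀ e y, |h e y| ≤ C) (h0 : ∀ y, ∑ e, M.p e y * h e y = 0) :
    ∀ᵐ σ ∂(M.pathMeasure x), Tendsto
      (fun n : ℕ => (∑ k ∈ Finset.range n, h (σ k) (M.orbit x σ k)) / n) atTop (𝓝 0) := by
  have h1 := ae_all_iff.2 fun m : ℕ => M.ae_eventually_sum_le x hC h0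
    (Nat.one_div_pos_of_nat (α := ℝ) (n := m))
  have h2 := ae_all_iff.2 fun m : ℕ => M.ae_eventually_sum_le x (h := fun e y => -h e y)
    (by simpa using hC) (by simpa using h0) (Nat.one_div_pos_of_nat (α := ℝ) (n := m))
  filter_upwards [h1, h2] with σ hσ1 hσ2
  rw [Metric.tendsto_nhds]
  intro ε hε
  obtain ⟨m, hm⟩ := exists_nat_one_div_lt hε
  filter_upwards [hσ1 m, hσ2 m, eventually_gt_atTop 0] with n hn1 hn2 hn
  have hn' : (0 : ℝ) < n := by exact_mod_cast hn
  rw [Finset.sum_neg_distrib] at hn2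
  rw [Real.dist_eq, sub_zero, abs_div, abs_of_pos hn', div_lt_iff₀ hn']
  have := mul_lt_mul_of_pos_left hm hn'
  rw [abs_lt]
  constructor <;> linarith

theorem ae_tendsto_average_sub (M : MarkovSystem K V E) (x : K) {h : E → K → ℝ} {C : ℝ}
    (hC : ∀ e y, |h e y| ≤ C) :
    ∀ᵐ σ ∂(M.pathMeasure x), Tendsto (fun n : ℕ => (∑ k ∈ Finset.range n,
      (h (σ k) (M.orbit x σ k) - ∑ e, M.p e (M.orbit x σ k) * h e (M.orbit x σ k))) / n)
      atTop (𝓝 0) := by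
  refine M.ae_tendsto_average_of_centered x (h := fun e y => h e y - ∑ e', M.p e' y * h e' y)
    (C := C + C) (fun e y => ?_) (fun y => ?_)
  · refine (abs_sub _ _).trans (add_le_add (hC e y) ?_)
    calc |∑ e', M.p e' y * h e' y| ≤ ∑ e', |M.p e' y * h e' y| := Finset.abs_sum_le_sum_abs _ _
      _ ≤ ∑ e', M.p e' y * C := by
        refine Finset.sum_le_sum fun e' _ => ?_
        rw [abs_mul, abs_of_nonneg (M.p_nonneg _ _)]
        exact mul_le_mul_of_nonneg_left (hC e' y) (M.p_nonneg _ _)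
      _ = C := by rw [← Finset.sum_mul, M.sum_p, one_mul]
  · simp only [mul_sub, Finset.sum_sub_distrib]
    rw [← Finset.sum_mul, M.sum_p, one_mul, sub_self]

end LawOfLargeNumbers

end MarkovSystem

/-! ### Clopen cells and the Feller property -/

lemma IsClopen.continuous_of_continuousOn_of_eq_zero {X : Type*} [TopologicalSpace X] {s : Set X}
    (hs : IsClopen s) {F : X → ℝ} (hF : ContinuousOn F s) (h0 : ∀ x ∉ s, F x = 0) :
    Continuous F := by
  refine continuous_iff_continuousAt.2 fun x => ?_
  by_cases hx : x ∈ s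
  · exact hF.continuousAt (hs.isOpen.mem_nhds hx)
  · refine continuousAt_const.congr (f := fun _ => (0 : ℝ)) ?_
    filter_upwards [hs.compl.isOpen.mem_nhds hx] with y hy
    exact (h0 y hy).symm

namespace MarkovSystem

section Feller

variable {K : Type*} [MetricSpace K] [MeasurableSpace K] {V E : Type*} [Fintype E]

lemma eq_of_mem_cell (M : MarkovSystem K V E) {u v : V} {x : K} (hu : x ∈ M.cell u)
    (hv : x ∈ M.cell v) : u = v := by
  by_contra h
  exact Set.disjoint_left.1 (M.disjoint_cell u v h) hu hv

lemma isClopen_cell (M : MarkovSystem K V E) (hopen : ∀ e, IsOpen (M.cell (M.i e))) (e : E) :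
    IsClopen (M.cell (M.i e)) := by
  refine ⟨⟨?_⟩, hopen e⟩
  have h : (M.cell (M.i e))ᶜ = ⋃ e' ∈ {e' | M.i e' ≠ M.i e}, M.cell (M.i e') := by
    ext x
    simp only [Set.mem_compl_iff, Set.mem_iUnion, Set.mem_ofPred_eq, exists_prop]
    constructor
    · intro hx
      obtain ⟨e', he'⟩ := M.exists_edge x
      exact ⟨e', fun h => hx (h ▸ he'), he'⟩
    · rintro ⟨e', hne, he'⟩ hx
      exact hne (M.eq_of_mem_cell he' hx)
  rw [h]
  exact isOpen_biUnion fun e' _ => hopen e'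

lemma continuous_sum_p_mul (M : MarkovSystem K V E) (hopen : ∀ e, IsOpen (M.cell (M.i e)))
    (hp : ∀ e, ContinuousOn (M.p e) (M.cell (M.i e))) {h : E → K → ℝ}
    (hh : ∀ e, ContinuousOn (h e) (M.cell (M.i e))) :
    Continuous fun x => ∑ e, M.p e x * h e x :=
  continuous_finsetSum _ fun e _ =>
    (M.isClopen_cell hopen e).continuous_of_continuousOn_of_eq_zero ((hp e).mul (hh e))
      fun x hx => by rw [M.p_eq_zero e x hx, zero_mul]

lemma continuous_U (M : MarkovSystem K V E) (hopen : ∀ e, IsOpen (M.cell (M.i e)))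
    (hw : ∀ e, ContinuousOn (M.w e) (M.cell (M.i e)))
    (hp : ∀ e, ContinuousOn (M.p e) (M.cell (M.i e))) {g : K → ℝ} (hg : Continuous g) :
    Continuous (M.U g) :=
  M.continuous_sum_p_mul hopen hp fun e => hg.comp_continuousOn (hw e)

/-- This Lipschitz bound, uniform in y, carries the vanishing of averages from a dense sequence to
all of C(K). -/
lemma abs_U_sub_sub_le [CompactSpace K] (M : MarkovSystem K V E) (g g' : C(K, ℝ)) (y : K) :
    |(M.U g y - g y) - (M.U g' y - g' y)| ≤ 2 * ‖g - g'‖ := by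
  have h1 : ∀ z, |g z - g' z| ≤ ‖g - g'‖ := fun z => (g - g').norm_coe_le_norm z
  have h2 : |M.U g y - M.U g' y| ≤ ‖g - g'‖ := by
    unfold U
    rw [← Finset.sum_sub_distrib]
    calc |∑ e, (M.p e y * g (M.w e y) - M.p e y * g' (M.w e y))|
        ≤ ∑ e, |M.p e y * g (M.w e y) - M.p e y * g' (M.w e y)| :=
          Finset.abs_sum_le_sum_abs _ _
      _ ≤ ∑ e, M.p e y * ‖g - g'‖ := by
        refine Finset.sum_le_sum fun e _ => ?_
        rw [← mul_sub, abs_mul, abs_of_nonneg (M.p_nonneg _ _)]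
        exact mul_le_mul_of_nonneg_left (h1 _) (M.p_nonneg _ _)
      _ = ‖g - g'‖ := by rw [← Finset.sum_mul, M.sum_p, one_mul]
  have h3 : (M.U g y - g y) - (M.U g' y - g' y) = (M.U g y - M.U g' y) - (g y - g' y) := by ring
  rw [h3]
  have := abs_sub (M.U g y - M.U g' y) (g y - g' y)
  linarith [h1 y]

end Feller

/-! ### Empirical measures and equidistribution -/

section Empirical

variable {K : Type*} [MetricSpace K] [MeasurableSpace K]

/-- The empirical distribution of the points `X 0, …, X n`. -/
noncomputable def empirical (X : ℕ → K) (n : ℕ) : Measure K :=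
  ((n + 1 : ℕ) : ℝ≥0∞)⁻¹ • ∑ k ∈ Finset.range (n + 1), Measure.dirac (X k)

instance isProbabilityMeasure_empirical (X : ℕ → K) (n : ℕ) :
    IsProbabilityMeasure (empirical X n) := by
  constructor
  simp only [empirical, Measure.smul_apply, Measure.coe_finsetSum, Finset.sum_apply,
    measure_univ, smul_eq_mul, Finset.sum_const, Finset.card_range, nsmul_eq_mul, mul_one]
  exact ENNReal.inv_mul_cancel (by simp) (ENNReal.natCast_ne_top _)

lemma integral_empirical [CompactSpace K] [BorelSpace K] (X : ℕ → K) (n : ℕ) {g : K → ℝ}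
    (hg : Continuous g) :
    ∫ x, g x ∂(empirical X n) =
      (∑ k ∈ Finset.range (n + 1), g (X k)) / ((n + 1 : ℕ) : ℝ) := by
  rw [empirical, integral_smul_measure, integral_finsetSum_measure]
  · simp only [integral_dirac, ENNReal.toReal_inv, ENNReal.toReal_natCast, smul_eq_mul]
    rw [div_eq_inv_mul]
  · exact fun k _ => hg.integrable_of_hasCompactSupport (HasCompactSupport.of_compactSpace g)

/-- If the averages of `U g - g` along a sequence tend to zero for every continuous `g`, and the
invariant measure is unique, then the sequence is equidistributed for that measure. -/
theorem tendsto_average_of_unique_invariant [CompactSpace K] [BorelSpace K]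
    {V E : Type*} [Fintype E] (M : MarkovSystem K V E)
    (hU : ∀ g : K → ℝ, Continuous g → Continuous (M.U g)) (μ : Measure K)
    (hμ_unique : ∀ ν : Measure K, IsProbabilityMeasure ν → M.IsInvariant ν → ν = μ)
    {X : ℕ → K}
    (hX : ∀ g : C(K, ℝ), Tendsto
      (fun n : ℕ => (∑ k ∈ Finset.range n, (M.U g (X k) - g (X k))) / (n : ℝ)) atTop (𝓝 0))
    {F : K → ℝ} (hF : Continuous F) :
    Tendsto (fun n : ℕ => (∑ k ∈ Finset.range n, F (X k)) / (n : ℝ)) atTop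
      (𝓝 (∫ x, F x ∂μ)) := by
  rw [← tendsto_add_atTop_iff_nat 1]
  simp only [← integral_empirical X _ hF]
  -- Along an ultrafilter, compactness yields a limit ν with no passage to subsequences.
  refine (tendsto_iff_ultrafilter _ _ _).2 fun G hG => ?_
  let P : ℕ → ProbabilityMeasure K := fun n => ⟨empirical X n, inferInstance⟩
  obtain ⟨ν, -, hν⟩ := isCompact_univ.ultrafilter_le_nhds (G.map P) (by simp)
  have hlim : ∀ g : K → ℝ, Continuous g →
      Tendsto (fun n => ∫ x, g x ∂(empirical X n)) G (𝓝 (∫ x, g x ∂(ν : Measure K))) :=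
    fun g hg => ProbabilityMeasure.tendsto_iff_forall_integral_tendsto.1
      (show Tendsto P G (𝓝 ν) from hν) (BoundedContinuousFunction.mkOfCompact ⟨g, hg⟩)
  have hinv : M.IsInvariant (ν : Measure K) := by
    intro g
    have hc : Continuous fun x => M.U g x - g x := (hU g g.continuous).sub g.continuous
    have h1 : Tendsto (fun n => ∫ x, (M.U g x - g x) ∂(empirical X n)) G (𝓝 0) := by
      simp only [integral_empirical X _ hc]
      exact ((tendsto_add_atTop_iff_nat 1).2 (hX g.toContinuousMap)).mono_left hG
    have h2 := tendsto_nhds_unique h1 (hlim _ hc)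
    have hint : ∀ f : K → ℝ, Continuous f → Integrable f (ν : Measure K) := fun f hf =>
      hf.integrable_of_hasCompactSupport (HasCompactSupport.of_compactSpace f)
    rw [integral_sub (hint _ (hU g g.continuous)) (hint _ g.continuous)] at h2
    linarith
  rw [← hμ_unique ν inferInstance hinv]
  exact hlim F hF

variable {V E : Type*} [Fintype E] [MeasurableSpace E] [MeasurableSingletonClass E]

/-- U g(X_k) - g(X_k) is the increment g(X_{k+1}) - g(X_k), which telescopes to a bounded quantity,
minus the centred term g(X_{k+1}) - U g(X_k). -/
lemma ae_tendsto_average_U_sub [CompactSpace K] (M : MarkovSystem K V E) (x : K) (g : C(K, ℝ)) :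
    ∀ᵐ σ ∂(M.pathMeasure x), Tendsto (fun n : ℕ =>
      (∑ k ∈ Finset.range n, (M.U g (M.orbit x σ k) - g (M.orbit x σ k))) / (n : ℝ))
      atTop (𝓝 0) := by
  filter_upwards [M.ae_tendsto_average_sub x (h := fun e y => g (M.w e y)) (C := ‖g‖)
    fun e y => g.norm_coe_le_norm _] with σ hσ
  have hb : Tendsto (fun n : ℕ => (g (M.orbit x σ n) - g x) / (n : ℝ)) atTop (𝓝 0) := by
    refine squeeze_zero_norm (a := fun n : ℕ => (‖g‖ + ‖g‖) / (n : ℝ)) (fun n => ?_)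
      (tendsto_const_div_atTop_nhds_zero_nat _)
    rw [norm_div, Real.norm_natCast]
    gcongr
    exact (norm_sub_le _ _).trans (add_le_add (g.norm_coe_le_norm _) (g.norm_coe_le_norm _))
  have h := hb.sub hσ
  rw [sub_zero] at h
  refine h.congr fun n => ?_
  rw [← sub_div]
  congr 1
  have ht := Finset.sum_range_sub (fun k => g (M.orbit x σ k)) n
  simp only [orbit, Finset.sum_sub_distrib] at ht
  simp only [U, Finset.sum_sub_distrib]
  linarith

/-- Separability of C(K) makes the exceptional null set independent of g. -/
lemma ae_forall_tendsto_average_U_sub [CompactSpace K] (M : MarkovSystem K V E) (x : K) :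
    ∀ᵐ σ ∂(M.pathMeasure x), ∀ g : C(K, ℝ), Tendsto (fun n : ℕ =>
      (∑ k ∈ Finset.range n, (M.U g (M.orbit x σ k) - g (M.orbit x σ k))) / (n : ℝ))
      atTop (𝓝 0) := by
  have h := ae_all_iff.2 fun m : ℕ =>
    M.ae_tendsto_average_U_sub x (TopologicalSpace.denseSeq C(K, ℝ) m)
  filter_upwards [h] with σ hσ g
  rw [Metric.tendsto_nhds]
  intro ε hε
  -- With ‖g - g'‖ < ε/4, replacing g by g' changes the average by less than ε/2.
  obtain ⟨m, hm⟩ := Metric.denseRange_iff.1 (TopologicalSpace.denseRange_denseSeq C(K, ℝ)) g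
    (ε / 4) (by positivity)
  rw [dist_eq_norm] at hm
  set g' := TopologicalSpace.denseSeq C(K, ℝ) m
  filter_upwards [Metric.tendsto_nhds.1 (hσ m) (ε / 2) (by positivity), eventually_gt_atTop 0]
    with n hn hn0
  have hn' : (0 : ℝ) < n := by exact_mod_cast hn0
  rw [Real.dist_eq, sub_zero, abs_div, abs_of_pos hn', div_lt_iff₀ hn'] at hn ⊢
  have hd : |∑ k ∈ Finset.range n, (M.U g (M.orbit x σ k) - g (M.orbit x σ k)) -
      ∑ k ∈ Finset.range n, (M.U g' (M.orbit x σ k) - g' (M.orbit x σ k))| ≤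
      n * (2 * ‖g - g'‖) := by
    rw [← Finset.sum_sub_distrib]
    refine (Finset.abs_sum_le_sum_abs _ _).trans ?_
    refine (Finset.sum_le_card_nsmul _ _ _ fun k _ => M.abs_U_sub_sub_le g g' _).trans_eq ?_
    simp
  have hm' := mul_lt_mul_of_pos_left hm hn'
  have := abs_sub_abs_le_abs_sub
    (∑ k ∈ Finset.range n, (M.U g (M.orbit x σ k) - g (M.orbit x σ k)))
    (∑ k ∈ Finset.range n, (M.U g' (M.orbit x σ k) - g' (M.orbit x σ k)))
  linarith

/-- The strong law of large numbers for functions of the steps of the process. -/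
theorem ae_tendsto_average [CompactSpace K] [BorelSpace K] (M : MarkovSystem K V E)
    (hopen : ∀ e, IsOpen (M.cell (M.i e)))
    (hw : ∀ e, ContinuousOn (M.w e) (M.cell (M.i e)))
    (hp : ∀ e, ContinuousOn (M.p e) (M.cell (M.i e)))
    (μ : Measure K)
    (hμ_unique : ∀ ν : Measure K, IsProbabilityMeasure ν → M.IsInvariant ν → ν = μ)
    {h : E → K → ℝ} (hh : ∀ e, Continuous (h e)) (x : K) :
    ∀ᵐ σ ∂(M.pathMeasure x), Tendsto
      (fun n : ℕ => (∑ k ∈ Finset.range n, h (σ k) (M.orbit x σ k)) / (n : ℝ)) atTop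
      (𝓝 (∫ y, ∑ e, M.p e y * h e y ∂μ)) := by
  have hC : ∀ e y, |h e y| ≤ ∑ e', ‖(⟨h e', hh e'⟩ : C(K, ℝ))‖ := fun e y =>
    ((⟨h e, hh e⟩ : C(K, ℝ)).norm_coe_le_norm y).trans
      (Finset.single_le_sum (f := fun e' => ‖(⟨h e', hh e'⟩ : C(K, ℝ))‖)
        (fun _ _ => norm_nonneg _) (Finset.mem_univ e))
  filter_upwards [M.ae_tendsto_average_sub x hC, M.ae_forall_tendsto_average_U_sub x]
    with σ h1 h2
  have h3 := M.tendsto_average_of_unique_invariant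
    (fun g hg => M.continuous_U hopen hw hp hg) μ hμ_unique h2
    (M.continuous_sum_p_mul hopen hp fun e => (hh e).continuousOn)
  have h4 := h1.add h3
  rw [zero_add] at h4
  refine h4.congr fun n => ?_
  rw [← add_div, ← Finset.sum_add_distrib]
  simp

end Empirical

end MarkovSystem

/-! ### From continuous to extended real-valued edge functions -/

theorem corollary1
    {K : Type*} [MetricSpace K] [CompactSpace K] [MeasurableSpace K] [BorelSpace K]
    {V : Type*} [Finite V]
    {E : Type*} [Fintype E] [MeasurableSpace E] [MeasurableSingletonClass E]
    (M : MarkovSystem K V E)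
    (hopen : ∀ e, IsOpen (M.cell (M.i e)))
    (hw : ∀ e, ContinuousOn (M.w e) (M.cell (M.i e)))
    (hp : ∀ e, ContinuousOn (M.p e) (M.cell (M.i e)))
    (hp_pos : ∀ e, ∃ δ : ℝ, 0 < δ ∧ ∀ x ∈ M.cell (M.i e), δ ≤ M.p e x)
    (μ : Measure K) [IsProbabilityMeasure μ]
    (hμ : M.IsInvariant μ)
    (hμ_unique : ∀ ν : Measure K, IsProbabilityMeasure ν → M.IsInvariant ν → ν = μ)
    (f : E → K → EReal)
    (hf_meas : ∀ e, Measurable (f e))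
    (hf_real : ∀ e, ∀ x ∈ M.cell (M.i e), f e x ≠ ⊥ ∧ f e x ≠ ⊤)
    (hf_cont : ∀ e, ContinuousOn (f e) (M.cell (M.i e))) :
    (∀ e, IntegrableOn (fun y => M.p e y * (f e y).toReal) (M.cell (M.i e)) μ) ∧
      ∀ x : K, ∀ᵐ σ ∂(M.pathMeasure x),
        Tendsto
          (fun n : ℕ => (∑ k ∈ Finset.range n, f (σ k) (M.orbit x σ k)) / (n : EReal))
          atTop
          (𝓝 ((∑ e, ∫ y in M.cell (M.i e), M.p e y * (f e y).toReal ∂μ : ℝ) : EReal)) := by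
  classical
  have htr : ∀ e, ContinuousOn (fun y => (f e y).toReal) (M.cell (M.i e)) := fun e =>
    EReal.continuousOn_toReal.comp (hf_cont e) fun y hy => by
      simp [(hf_real e y hy).1, (hf_real e y hy).2]
  have hpf : ∀ e, Continuous fun y => M.p e y * (f e y).toReal := fun e =>
    (M.isClopen_cell hopen e).continuous_of_continuousOn_of_eq_zero ((hp e).mul (htr e))
      fun y hy => by rw [M.p_eq_zero e y hy, zero_mul]
  have hint : ∀ e, Integrable (fun y => M.p e y * (f e y).toReal) μ := fun e =>
    (hpf e).integrable_of_hasCompactSupport (HasCompactSupport.of_compactSpace _)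
  refine ⟨fun e => (hint e).integrableOn, fun x => ?_⟩
  -- A continuous real version of `f`: weighting by `M.p e` hides the change off the cell, and
  -- almost every path only evaluates `f` inside the cells.
  let φ : E → K → ℝ := fun e => (M.cell (M.i e)).indicator fun y => (f e y).toReal
  have hφ : ∀ e, Continuous (φ e) := fun e =>
    (M.isClopen_cell hopen e).continuous_of_continuousOn_of_eq_zero
      ((htr e).congr fun y hy => Set.indicator_of_mem hy _)
      fun y hy => Set.indicator_of_notMem hy _
  have hpφ : ∀ e y, M.p e y * φ e y = M.p e y * (f e y).toReal := by
    intro e y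
    by_cases hy : y ∈ M.cell (M.i e)
    · simp only [φ, Set.indicator_of_mem hy]
    · simp [M.p_eq_zero e y hy]
  have hval : ∫ y, ∑ e, M.p e y * φ e y ∂μ =
      ∑ e, ∫ y in M.cell (M.i e), M.p e y * (f e y).toReal ∂μ := by
    simp only [hpφ]
    rw [integral_finsetSum _ fun e _ => hint e]
    refine Finset.sum_congr rfl fun e _ => ?_
    exact (setIntegral_eq_integral_of_forall_compl_eq_zero fun y hy => by
      rw [M.p_eq_zero e y hy, zero_mul]).symm
  filter_upwards [M.ae_tendsto_average hopen hw hp μ hμ_unique hφ x, M.ae_mem_cell x]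
    with σ h1 h2
  rw [hval] at h1
  refine (continuous_coe_real_ereal.continuousAt.tendsto.comp h1).congr fun n => ?_
  have hk : ∀ k, f (σ k) (M.orbit x σ k) = (φ (σ k) (M.orbit x σ k) : ℝ) := fun k => by
    simp only [φ, Set.indicator_of_mem (h2 k)]
    exact (EReal.coe_toReal (hf_real _ _ (h2 k)).2 (hf_real _ _ (h2 k)).1).symm
  have hs : ∀ m : ℕ, ((∑ k ∈ Finset.range m, φ (σ k) (M.orbit x σ k) : ℝ) : EReal) =
      ∑ k ∈ Finset.range m, ((φ (σ k) (M.orbit x σ k) : ℝ) : EReal) := by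
    intro m
    induction m with
    | zero => simp
    | succ m ih => rw [Finset.sum_range_succ, Finset.sum_range_succ, EReal.coe_add, ih]
  simp only [Function.comp_apply, hk, ← hs, EReal.coe_div, EReal.coe_natCast]
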